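/- Let $q$ be a complex number with $|q|<1$. Write $(a)_0=1$, $(a)_n=\prod_{k=0}^{n-1}(1-aq^k)$ for $n\ge 1$, and $(a)_\infty=\lim_{n\to\infty}(a)_n$, and let $$\sigma_2(q):=\sum_{n=0}^{\infty}\frac{(-1)^nq^{n^2}}{(-q)_n}.$$ Then the limit $(-q)_\infty$ exists and is nonzero, the series defining $\sigma_2(q)$ and the two infinite series over $n$ below converge absolutely, and $$\textup{(i)}\quad \sigma_2(q)=\frac{1}{(-q)_{\infty}}\left\{1+\sum_{n=1}^{\infty}\frac{(-1)^nq^{n(5n-1)/2}(1+q^{2n})}{1+q^n}\sum_{j=0}^{n}\frac{(-1)_j}{(q)_j}\left(-q^{1-n}\right)^j\right\},$$ $$\textup{(ii)}\quad \sigma_2(q)=\frac{1}{(-q)_{\infty}}\left\{1-\sum_{n=1}^{\infty}\frac{(-1)^nq^{n(5n-1)/2}(1+q^{2n})}{1-q^n}\sum_{m=0}^{n-1}\frac{(-1)_m}{(q)_m}\left(-q^{-n}\right)^m\right\}.$$ (For $q=0$ each summand over $n\ge1$ in (i) and (ii) is understood by its limiting value $0$ as $q\to0$.) -/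

import Mathlib

open Filter Topology

/-- The finite `q`-shifted factorial `(a; q)_n = (1 - a)(1 - a q) ⋯ (1 - a q^(n-1))`. -/
noncomputable def qPoch (a q : ℂ) (n : ℕ) : ℂ :=
  ∏ k ∈ Finset.range n, (1 - a * q ^ k)

/-- The infinite `q`-shifted factorial `(a; q)_∞ = lim_{n → ∞} (a; q)_n`. -/
noncomputable def qPochInf (a q : ℂ) : ℂ :=
  limUnder atTop (fun n : ℕ => qPoch a q n)

/-- The `n`-th term of the series defining the rank parity function `σ₂(q)`. -/
noncomputable def sigma2Term (q : ℂ) (n : ℕ) : ℂ :=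
  (-1) ^ n * q ^ (n ^ 2) / qPoch (-q) q n

/-- `σ₂(q) = ∑_{n ≥ 0} (-1)^n q^(n^2) / (-q; q)_n`. -/
noncomputable def sigma2 (q : ℂ) : ℂ :=
  ∑' n : ℕ, sigma2Term q n

/-- The `n`-th term, for `n ≥ 1`, of the series in the first representation.
The division by `2` in the exponent is exact and the subtraction there does not truncate. -/
noncomputable def heckeTermOne (q : ℂ) (n : ℕ) : ℂ :=
  (-1) ^ n * q ^ (n * (5 * n - 1) / 2) * (1 + q ^ (2 * n)) / (1 + q ^ n) *
    ∑ j ∈ Finset.range (n + 1),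
      qPoch (-1) q j / qPoch q q j * (-(q ^ (1 - (n : ℤ)))) ^ j

/-- The `n`-th term, for `n ≥ 1`, of the series in the second representation. -/
noncomputable def heckeTermTwo (q : ℂ) (n : ℕ) : ℂ :=
  (-1) ^ n * q ^ (n * (5 * n - 1) / 2) * (1 + q ^ (2 * n)) / (1 - q ^ n) *
    ∑ m ∈ Finset.range n,
      qPoch (-1) q m / qPoch q q m * (-(q ^ (-(n : ℤ)))) ^ m

/-!
The identities are the limit `N → ∞` of a finite Bailey lemma applied to a Bailey pair relative
to `a = -1`.

Since `-q = a q` for `a = -1`, the series `σ₂(q)` is `∑ a^n q^(n^2) β_n` with `β_n = 1 / (aq)_n`.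
For any Bailey pair, `finite_bailey_lemma` rewrites
`∑_{n ≤ N} a^n q^(n^2) β_n / (q)_{N-n}` as `∑_{r ≤ N} a^r q^(r^2) α_r / ((q)_{N-r} (aq)_{N+r})`;
it rests on the finite Cauchy identity `sum_pow_sq_div_qPoch`. Letting `N → ∞` by dominated
convergence (`tendsto_sum_range_mul`) and cancelling `(q)_∞` expresses `σ₂(q)` as
`(aq)_∞⁻¹ ∑ a^r q^(r^2) α_r`. Working with finite sums until the end means that no double series
has to be rearranged.

What remains is that `α_r = (1 + q^(2r)) D_r`, with `D = baileyD` built from the truncated series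
`∑_{j ≤ r} (-1)_j / (q)_j z^j` at `z = -q^(1-r)`, corresponds to `β_n = 1 / (-q)_n`. The
`q`-difference equation of the series (`truncSeries_sub`) becomes a first-order recurrence for `D`
(`baileyD_succ`). That recurrence makes the sum for `(1 + q^n) β_n - β_(n-1)` telescope, with the
explicit partial sums of `partial_sum_bailey_difference`, and the full sum is zero
(`inv_qPoch_eq_bailey_sum`).

The same `q`-difference equation, now at `z = -q^(-n)`, shows that the terms of the second series
are the negatives of those of the first (`heckeTermTwo_succ`). The value `q = 0`, where negative
powers of `q` are junk, is checked directly.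
-/

/-! ### Finite `q`-shifted factorials -/

theorem qPoch_zero (a q : ℂ) : qPoch a q 0 = 1 := by simp [qPoch]

theorem qPoch_succ (a q : ℂ) (n : ℕ) :
    qPoch a q (n + 1) = qPoch a q n * (1 - a * q ^ n) := by
  simp [qPoch, Finset.prod_range_succ]

theorem qPoch_add (a q : ℂ) (m n : ℕ) :
    qPoch a q (m + n) = qPoch a q m * qPoch (a * q ^ m) q n := by
  simp only [qPoch, Finset.prod_range_add]
  congr 1
  refine Finset.prod_congr rfl fun k _ => ?_
  ring

theorem qPoch_succ_left (a q : ℂ) (n : ℕ) :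
    qPoch a q (n + 1) = (1 - a) * qPoch (a * q) q n := by
  rw [add_comm, qPoch_add, pow_one]
  simp [qPoch]

theorem qPoch_ne_zero {a q : ℂ} (h : ∀ k : ℕ, 1 - a * q ^ k ≠ 0) (n : ℕ) :
    qPoch a q n ≠ 0 :=
  Finset.prod_ne_zero_iff.mpr fun k _ => h k

theorem one_sub_mul_pow_ne_zero {a q : ℂ} (ha : ‖a‖ < 1) (hq : ‖q‖ < 1) (k : ℕ) :
    1 - a * q ^ k ≠ 0 := by
  intro h
  have h1 : ‖a * q ^ k‖ = 1 := by rw [← sub_eq_zero.mp h, norm_one]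
  rw [norm_mul, norm_pow] at h1
  have h2 : ‖q‖ ^ k ≤ 1 := pow_le_one₀ (norm_nonneg q) hq.le
  nlinarith [norm_nonneg a]

/-! ### The finite Bailey lemma -/

/-- A finite form of Cauchy's identity
`∑ x^m q^(m^2) / ((q)_m (xq)_m) = 1 / (xq)_∞`, a case of the `q`-Chu–Vandermonde sum.
The `q`-Pascal rule lets `N` grow by one, at the cost of replacing `x` by `x q`. -/
theorem sum_pow_sq_div_qPoch {q : ℂ} (hq : ∀ k : ℕ, 1 - q * q ^ k ≠ 0) (N : ℕ) :
    ∀ x : ℂ, (∀ k : ℕ, 1 - x * q * q ^ k ≠ 0) →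
      ∑ m ∈ Finset.range (N + 1),
        x ^ m * q ^ (m ^ 2) / (qPoch q q m * qPoch q q (N - m) * qPoch (x * q) q m) =
      1 / (qPoch q q N * qPoch (x * q) q N) := by
  induction N with
  | zero => intro x _; simp [qPoch]
  | succ N ih =>
    intro x hx
    have hx' : ∀ k : ℕ, 1 - x * q * q * q ^ k ≠ 0 := fun k => by
      have := hx (k + 1)
      rwa [pow_succ', ← mul_assoc] at this
    have hP := qPoch_ne_zero hq
    have hX := qPoch_ne_zero hx
    have hX' := qPoch_ne_zero hx'
    have hx0 : 1 - x * q ≠ 0 := by simpa using hx 0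
    have key : (1 - q * q ^ N) * ∑ m ∈ Finset.range (N + 1 + 1),
        x ^ m * q ^ (m ^ 2) / (qPoch q q m * qPoch q q (N + 1 - m) * qPoch (x * q) q m) =
        ∑ m ∈ Finset.range (N + 1),
          x ^ m * q ^ (m ^ 2) / (qPoch q q m * qPoch q q (N - m) * qPoch (x * q) q m) +
        x * q ^ (N + 1) / (1 - x * q) * ∑ m ∈ Finset.range (N + 1),
          (x * q) ^ m * q ^ (m ^ 2) /
            (qPoch q q m * qPoch q q (N - m) * qPoch (x * q * q) q m) := by
      have hsplit : ∀ m ∈ Finset.range (N + 1 + 1), (1 - q * q ^ N) *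
          (x ^ m * q ^ (m ^ 2) / (qPoch q q m * qPoch q q (N + 1 - m) * qPoch (x * q) q m)) =
          x ^ m * q ^ (m ^ 2) * (1 - q ^ (N + 1 - m)) /
            (qPoch q q m * qPoch q q (N + 1 - m) * qPoch (x * q) q m) +
          x ^ m * q ^ (m ^ 2) * (q ^ (N + 1 - m) * (1 - q ^ m)) /
            (qPoch q q m * qPoch q q (N + 1 - m) * qPoch (x * q) q m) := by
        intro m hm
        have e : q * q ^ N = q ^ (N + 1 - m) * q ^ m := by
          rw [← pow_add, ← pow_succ']
          congr 1
          have := Finset.mem_range.mp hm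
          omega
        rw [e]
        ring
      rw [Finset.mul_sum, Finset.sum_congr rfl hsplit, Finset.sum_add_distrib]
      congr 1
      · rw [Finset.sum_range_succ]
        simp only [Nat.sub_self, pow_zero, sub_self, mul_zero, zero_div, add_zero]
        refine Finset.sum_congr rfl fun m hm => ?_
        obtain ⟨d, rfl⟩ := Nat.exists_eq_add_of_le (Nat.lt_succ_iff.mp (Finset.mem_range.mp hm))
        have e1 : m + d + 1 - m = d + 1 := by omega
        have e2 : m + d - m = d := by omega
        rw [e1, e2, qPoch_succ, pow_succ']
        have := hP m; have := hP d; have := hX m; have := hq d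
        field_simp
        ring
      · rw [Finset.sum_range_succ']
        simp only [pow_zero, sub_self, mul_zero, zero_div, add_zero]
        rw [Finset.mul_sum]
        refine Finset.sum_congr rfl fun m hm => ?_
        obtain ⟨d, rfl⟩ := Nat.exists_eq_add_of_le (Nat.lt_succ_iff.mp (Finset.mem_range.mp hm))
        have e1 : m + d + 1 - (m + 1) = d := by omega
        have e2 : m + d - m = d := by omega
        rw [e1, e2, qPoch_succ, qPoch_succ_left (x * q), pow_succ' q m]
        have := hP m; have := hP d; have := hX' m; have := hq m
        field_simp
        ring
    rw [ih x hx, ih (x * q) hx'] at key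
    have e' : (1 - x * q) * qPoch (x * q * q) q N = qPoch (x * q) q N * (1 - x * q * q ^ N) :=
      (qPoch_succ_left (x * q) q N).symm.trans (qPoch_succ (x * q) q N)
    have hr : x * q ^ (N + 1) / (1 - x * q) * (1 / (qPoch q q N * qPoch (x * q * q) q N)) =
        x * q ^ (N + 1) / (qPoch q q N * (qPoch (x * q) q N * (1 - x * q * q ^ N))) := by
      rw [← e']
      have := hP N; have := hX' N
      field_simp
    rw [hr] at key
    apply mul_left_cancel₀ (hq N)
    rw [key, qPoch_succ, qPoch_succ]
    have := hP N; have := hX N; have := hq N; have := hx N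
    field_simp
    ring

/-- The limiting case `ρ₁, ρ₂ → ∞` of the finite Bailey lemma, for a Bailey pair `(α, β)`
relative to `a`. -/
theorem finite_bailey_lemma {a q : ℂ} (hq : ∀ k : ℕ, 1 - q * q ^ k ≠ 0)
    (ha : ∀ k : ℕ, 1 - a * q * q ^ k ≠ 0) {α β : ℕ → ℂ}
    (hβ : ∀ n, β n = ∑ r ∈ Finset.range (n + 1),
      α r / (qPoch q q (n - r) * qPoch (a * q) q (n + r))) (N : ℕ) :
    ∑ n ∈ Finset.range (N + 1), a ^ n * q ^ (n ^ 2) * β n / qPoch q q (N - n) =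
      ∑ r ∈ Finset.range (N + 1), a ^ r * q ^ (r ^ 2) * α r /
        (qPoch q q (N - r) * qPoch (a * q) q (N + r)) := by
  have hP := qPoch_ne_zero hq
  have hA := qPoch_ne_zero ha
  have h1 : ∑ n ∈ Finset.range (N + 1), a ^ n * q ^ (n ^ 2) * β n / qPoch q q (N - n) =
      ∑ n ∈ Finset.range (N + 1), ∑ r ∈ Finset.range (n + 1),
        a ^ n * q ^ (n ^ 2) * (α r / (qPoch q q (n - r) * qPoch (a * q) q (n + r))) /
          qPoch q q (N - n) := by
    refine Finset.sum_congr rfl fun n _ => ?_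
    rw [hβ, Finset.mul_sum, Finset.sum_div]
  rw [h1, Finset.sum_comm' (t' := Finset.range (N + 1)) (s' := fun r => Finset.Ico r (N + 1))
    (fun n r => by simp only [Finset.mem_range, Finset.mem_Ico]; omega)]
  refine Finset.sum_congr rfl fun r hr => ?_
  obtain ⟨M, rfl⟩ := Nat.exists_eq_add_of_le (Nat.lt_succ_iff.mp (Finset.mem_range.mp hr))
  have hx : ∀ k : ℕ, 1 - a * q ^ (2 * r) * q * q ^ k ≠ 0 := fun k => by
    have := ha (2 * r + k)
    rw [pow_add] at this
    convert this using 1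
    ring
  have hX := qPoch_ne_zero hx
  have e0 : r + M + 1 - r = M + 1 := by omega
  have e1 : r + M - r = M := by omega
  have e2 : a * q * q ^ (2 * r) = a * q ^ (2 * r) * q := by ring
  have e3 : r + M + r = 2 * r + M := by ring
  rw [Finset.sum_Ico_eq_sum_range, e0, e1, e3, qPoch_add, e2]
  trans a ^ r * q ^ (r ^ 2) * α r / qPoch (a * q) q (2 * r) *
    ∑ m ∈ Finset.range (M + 1), (a * q ^ (2 * r)) ^ m * q ^ (m ^ 2) /
      (qPoch q q m * qPoch q q (M - m) * qPoch (a * q ^ (2 * r) * q) q m)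
  · rw [Finset.mul_sum]
    refine Finset.sum_congr rfl fun m _ => ?_
    have e4 : r + m - r = m := by omega
    have e5 : r + M - (r + m) = M - m := by omega
    have e6 : r + m + r = 2 * r + m := by ring
    rw [e4, e5, e6, qPoch_add, e2]
    have := hP m; have := hP (M - m); have := hX m; have := hA (2 * r)
    field_simp
    ring
  · rw [sum_pow_sq_div_qPoch hq M _ hx]
    have := hP M; have := hX M; have := hA (2 * r)
    field_simp

/-! ### A Bailey pair relative to `-1` -/

/-- The sequence `(-1)^n q^(n(n+1)/2) (-1)_n / (q)_n`, which drives the recurrence of the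
Bailey pair. -/
noncomputable def baileySource (q : ℂ) (n : ℕ) : ℂ :=
  (-1) ^ n * q ^ (n * (n + 1) / 2) * qPoch (-1) q n / qPoch q q n

theorem baileySource_succ {q : ℂ} (hq : ∀ k : ℕ, 1 - q * q ^ k ≠ 0) (n : ℕ) :
    baileySource q (n + 1) =
      -(q ^ (n + 1) * (1 + q ^ n) / (1 - q ^ (n + 1)) * baileySource q n) := by
  have e : (n + 1) * (n + 1 + 1) / 2 = n * (n + 1) / 2 + (n + 1) := by
    rw [show (n + 1) * (n + 1 + 1) = n * (n + 1) + (n + 1) * 2 by ring,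
      Nat.add_mul_div_right _ _ two_pos]
  rw [baileySource, baileySource, e, pow_add, qPoch_succ, qPoch_succ, pow_succ' q n]
  have := qPoch_ne_zero hq n; have := hq n
  field_simp
  ring

/-- A closed form for the partial sums of the difference `(1 + q^n) β_n - β_(n-1)`, where
`n = m + d`. It vanishes at `d = 0`, that is, for the full sum. -/
theorem partial_sum_bailey_difference {q : ℂ} (hq : ∀ k : ℕ, 1 - q * q ^ k ≠ 0)
    (hq' : ∀ k : ℕ, 1 - -q * q ^ k ≠ 0) {D : ℕ → ℂ} (h0 : D 0 = 1 / 2)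
    (hD : ∀ n, (1 + q ^ (n + 1)) * D (n + 1) = -((1 - q ^ n) * q ^ (3 * n + 1) * D n) -
      q ^ (n + 1) * (1 + q ^ (2 * n + 1)) / (1 - q ^ (n + 1)) * baileySource q n) (m : ℕ) :
    ∀ d : ℕ, m + d ≠ 0 →
      ∑ r ∈ Finset.range (m + 1), (1 + q ^ (2 * r)) *
          (q ^ (m + d) + q ^ (m + d - r) - q ^ (m + d + r) + q ^ (2 * (m + d))) * D r /
          (qPoch q q (m + d - r) * qPoch (-q) q (m + d + r)) =
        q ^ (m + d) * (1 - q ^ d) / (qPoch q q d * qPoch (-q) q (m + d + m)) *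
          (D m * (1 - q ^ m) * q ^ (2 * m) +
            baileySource q m * (1 + q ^ (m + d + m)) / (1 - q ^ (m + d))) := by
  have hP := qPoch_ne_zero hq
  have hM := qPoch_ne_zero hq'
  have hs : ∀ k : ℕ, 1 - q ^ (k + 1) ≠ 0 := fun k => by simpa [pow_succ'] using hq k
  have hs' : ∀ k : ℕ, 1 + q ^ (k + 1) ≠ 0 := fun k => by simpa [pow_succ'] using hq' k
  induction m with
  | zero =>
    intro d hd
    obtain ⟨d, rfl⟩ : ∃ k, d = k + 1 := Nat.exists_eq_succ_of_ne_zero (by omega)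
    simp only [zero_add, Finset.sum_range_one, h0, baileySource,
      mul_zero, add_zero, Nat.sub_zero, qPoch_zero, pow_zero]
    have := hP (d + 1); have := hM (d + 1); have := hs d
    field_simp
    ring
  | succ m ih =>
    intro d _
    have ih' := ih (d + 1) (by omega)
    have e1 : m + (d + 1) = m + 1 + d := by omega
    rw [e1] at ih'
    rw [Finset.sum_range_succ, ih', baileySource_succ hq]
    have e2 : m + 1 + d - (m + 1) = d := by omega
    have e3 : m + 1 + d + (m + 1) = m + 1 + d + m + 1 := by omega
    have hD' : D (m + 1) = (-((1 - q ^ m) * q ^ (3 * m + 1) * D m) -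
        q ^ (m + 1) * (1 + q ^ (2 * m + 1)) / (1 - q ^ (m + 1)) * baileySource q m) /
          (1 + q ^ (m + 1)) := by
      rw [← hD, mul_div_cancel_left₀ _ (hs' m)]
    rw [e2, e3, hD', qPoch_succ q q d, qPoch_succ (-q) q (m + 1 + d + m),
      neg_mul, sub_neg_eq_add]
    have a1 := hP d; have a2 := hM (m + 1 + d + m); have a3 := hs m; have a4 := hs' m
    have a5 := hq d; have a6 := hq' (m + 1 + d + m); have a7 := hs (m + d)
    generalize qPoch q q d = A at *
    generalize qPoch (-q) q (m + 1 + d + m) = B at *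
    generalize baileySource q m = E at *
    generalize D m = F at *
    simp only [show 2 * (m + 1 + d) = m + m + d + d + 1 + 1 by omega,
      show 2 * (m + 1) = m + m + 1 + 1 by omega, show 2 * m = m + m by omega,
      show 3 * m = m + m + m by omega, pow_add, pow_one] at *
    generalize q ^ m = X at *
    generalize q ^ d = Y at *
    have a7' : 1 - X * q * Y ≠ 0 := by convert a7 using 1; ring
    have a6' : 1 + X ^ 2 * q ^ 2 * Y ≠ 0 := by convert a6 using 1; ring
    field_simp
    ring

/-- `1 / (-q)_n` is the `β` of the Bailey pair relative to `-1` with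
`α_n = (1 + q^(2n)) D_n`, where `D` satisfies a first-order recurrence. -/
theorem inv_qPoch_eq_bailey_sum {q : ℂ} (hq : ∀ k : ℕ, 1 - q * q ^ k ≠ 0)
    (hq' : ∀ k : ℕ, 1 - -q * q ^ k ≠ 0) {D : ℕ → ℂ} (h0 : D 0 = 1 / 2)
    (hD : ∀ n, (1 + q ^ (n + 1)) * D (n + 1) = -((1 - q ^ n) * q ^ (3 * n + 1) * D n) -
      q ^ (n + 1) * (1 + q ^ (2 * n + 1)) / (1 - q ^ (n + 1)) * baileySource q n) (n : ℕ) :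
    1 / qPoch (-q) q n = ∑ r ∈ Finset.range (n + 1),
      (1 + q ^ (2 * r)) * D r / (qPoch q q (n - r) * qPoch (-q) q (n + r)) := by
  have hP := qPoch_ne_zero hq
  have hM := qPoch_ne_zero hq'
  induction n with
  | zero => simp [qPoch, h0]; norm_num
  | succ n ih =>
    have hz := partial_sum_bailey_difference hq hq' h0 hD (n + 1) 0 (by omega)
    simp only [add_zero, pow_zero, sub_self, mul_zero, zero_div, zero_mul] at hz
    have hsum : (1 - -q * q ^ n) * ∑ r ∈ Finset.range (n + 1 + 1),
          (1 + q ^ (2 * r)) * D r / (qPoch q q (n + 1 - r) * qPoch (-q) q (n + 1 + r)) -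
        ∑ r ∈ Finset.range (n + 1),
          (1 + q ^ (2 * r)) * D r / (qPoch q q (n - r) * qPoch (-q) q (n + r)) = 0 := by
      rw [← hz, Finset.sum_range_succ, Finset.sum_range_succ _ (n + 1), mul_add, Finset.mul_sum,
        add_sub_right_comm, ← Finset.sum_sub_distrib]
      congr 1
      · refine Finset.sum_congr rfl fun r hr => ?_
        obtain ⟨d, rfl⟩ := Nat.exists_eq_add_of_le (Nat.lt_succ_iff.mp (Finset.mem_range.mp hr))
        have e1 : r + d + 1 - r = d + 1 := by omega
        have e2 : r + d - r = d := by omega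
        have e3 : r + d + 1 + r = r + d + r + 1 := by omega
        rw [e1, e2, e3, qPoch_succ, qPoch_succ, neg_mul, sub_neg_eq_add]
        have := hP d; have := hM (r + d + r); have := hq d
        have : 1 + q * q ^ (r + d + r) ≠ 0 := by simpa using hq' (r + d + r)
        rw [neg_mul, sub_neg_eq_add]
        field_simp
        ring
      · have := hP (n + 1 - (n + 1)); have := hM (n + 1 + (n + 1))
        field_simp
        simp
        ring
    rw [← ih, sub_eq_zero] at hsum
    apply mul_left_cancel₀ (hq' n)
    rw [hsum, qPoch_succ, mul_one_div, mul_comm (qPoch (-q) q n), ← div_div, div_self (hq' n)]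

/-! ### The truncated `q`-binomial series -/

/-- The first `n` terms of the series `∑ (-1)_j / (q)_j z^j`, whose sum is `(-z)_∞ / (z)_∞`. -/
noncomputable def truncSeries (q : ℂ) (n : ℕ) (z : ℂ) : ℂ :=
  ∑ j ∈ Finset.range n, qPoch (-1) q j / qPoch q q j * z ^ j

/-- The truncated form of the `q`-difference equation `f(z) - f(qz) = z (f(z) + f(qz))`. -/
theorem truncSeries_sub {q : ℂ} (hq : ∀ k : ℕ, 1 - q * q ^ k ≠ 0) (n : ℕ) (z : ℂ) :
    truncSeries q (n + 1) z - truncSeries q (n + 1) (q * z) =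
      z * (truncSeries q n z + truncSeries q n (q * z)) := by
  simp only [truncSeries]
  rw [Finset.sum_range_succ', Finset.sum_range_succ', ← Finset.sum_add_distrib, Finset.mul_sum,
    pow_zero, pow_zero, add_sub_add_right_eq_sub, ← Finset.sum_sub_distrib]
  refine Finset.sum_congr rfl fun j _ => ?_
  have hc : qPoch (-1) q (j + 1) / qPoch q q (j + 1) * (1 - q * q ^ j) =
      qPoch (-1) q j / qPoch q q j * (1 + q ^ j) := by
    have h := qPoch_ne_zero hq j
    rw [qPoch_succ, qPoch_succ, div_mul_eq_mul_div, div_mul_eq_mul_div,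
      div_eq_div_iff (mul_ne_zero h (hq j)) h]
    ring
  rw [mul_pow, mul_pow]
  linear_combination z * z ^ j * hc

theorem truncSeries_succ (q : ℂ) (n : ℕ) (z : ℂ) :
    truncSeries q (n + 1) z =
      truncSeries q n z + qPoch (-1) q n / qPoch q q n * z ^ n :=
  Finset.sum_range_succ _ _

theorem heckeTermOne_eq (q : ℂ) (n : ℕ) :
    heckeTermOne q n = (-1) ^ n * q ^ (n * (5 * n - 1) / 2) * (1 + q ^ (2 * n)) / (1 + q ^ n) *
      truncSeries q (n + 1) (-(q ^ (1 - (n : ℤ)))) := rfl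

theorem heckeTermTwo_eq (q : ℂ) (n : ℕ) :
    heckeTermTwo q n = (-1) ^ n * q ^ (n * (5 * n - 1) / 2) * (1 + q ^ (2 * n)) / (1 - q ^ n) *
      truncSeries q n (-(q ^ (-(n : ℤ)))) := rfl

/-- The two series agree term by term up to sign: at `z = -q^(-n)` the boundary terms of the
truncated `q`-difference equation cancel. -/
theorem heckeTermTwo_succ {q : ℂ} (hq0 : q ≠ 0) (hq : ∀ k : ℕ, 1 - q * q ^ k ≠ 0)
    (hq' : ∀ k : ℕ, 1 - -q * q ^ k ≠ 0) (n : ℕ) :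
    heckeTermTwo q (n + 1) = -heckeTermOne q (n + 1) := by
  rw [heckeTermOne_eq, heckeTermTwo_eq]
  have hw : q * -(q ^ (-((n + 1 : ℕ) : ℤ))) = -(q ^ (1 - ((n + 1 : ℕ) : ℤ))) := by
    rw [sub_eq_add_neg, zpow_add₀ hq0, zpow_one]
    ring
  have h := truncSeries_sub hq (n + 1) (-(q ^ (-((n + 1 : ℕ) : ℤ))))
  rw [truncSeries_succ q (n + 1) (-(q ^ (-((n + 1 : ℕ) : ℤ)))), hw] at h
  have h2 := truncSeries_succ q (n + 1) (-(q ^ (1 - ((n + 1 : ℕ) : ℤ))))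
  have hz : q ^ (-((n + 1 : ℕ) : ℤ)) * q ^ (n + 1) = 1 := by
    rw [zpow_neg, zpow_natCast, inv_mul_cancel₀ (pow_ne_zero _ hq0)]
  have hpow : (-(q ^ (1 - ((n + 1 : ℕ) : ℤ)))) ^ (n + 1) =
      q ^ (n + 1) * (-(q ^ (-((n + 1 : ℕ) : ℤ)))) ^ (n + 1) := by
    rw [← hw, mul_pow]
  rw [hpow] at h2
  generalize truncSeries q (n + 1) (-(q ^ (1 - ((n + 1 : ℕ) : ℤ)))) = T' at *
  generalize truncSeries q (n + 1 + 1) (-(q ^ (1 - ((n + 1 : ℕ) : ℤ)))) = T at *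
  generalize truncSeries q (n + 1) (-(q ^ (-((n + 1 : ℕ) : ℤ)))) = U at *
  generalize (-(q ^ (-((n + 1 : ℕ) : ℤ)))) ^ (n + 1) = W at *
  generalize q ^ (-((n + 1 : ℕ) : ℤ)) = Z at *
  have a1 : 1 - q ^ (n + 1) ≠ 0 := by simpa [pow_succ'] using hq n
  have a2 : 1 + q ^ (n + 1) ≠ 0 := by simpa [pow_succ'] using hq' n
  have hUT : (1 + q ^ (n + 1)) * U = -((1 - q ^ (n + 1)) * T) := by
    generalize qPoch (-1) q (n + 1) / qPoch q q (n + 1) = c at *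
    generalize q ^ (n + 1) = Q at *
    linear_combination Q * h - (U + T') * hz + h2
  rw [div_mul_eq_mul_div, div_mul_eq_mul_div, ← neg_div, div_eq_div_iff a1 a2]
  linear_combination (-1) ^ (n + 1) * q ^ ((n + 1) * (5 * (n + 1) - 1) / 2) *
    (1 + q ^ (2 * (n + 1))) * hUT

/-- The sequence `D` for which `α_n = (1 + q^(2n)) D_n` and `β_n = 1 / (-q)_n` form a Bailey
pair relative to `-1`. The exponent `n (3n - 1) / 2` is a natural number. -/
noncomputable def baileyD (q : ℂ) (n : ℕ) : ℂ :=
  q ^ (n * (3 * n - 1) / 2) / (1 + q ^ n) * truncSeries q (n + 1) (-(q ^ (1 - (n : ℤ))))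

theorem baileyD_zero (q : ℂ) : baileyD q 0 = 1 / 2 := by
  simp [baileyD, truncSeries, qPoch]
  norm_num

theorem heckeTermOne_eq_baileyD (q : ℂ) (n : ℕ) :
    heckeTermOne q n = (-1) ^ n * q ^ (n ^ 2) * ((1 + q ^ (2 * n)) * baileyD q n) := by
  have e : n * (5 * n - 1) / 2 = n ^ 2 + n * (3 * n - 1) / 2 := by
    rcases n with _ | n
    · rfl
    · rw [show 5 * (n + 1) - 1 = 5 * n + 4 by omega, show 3 * (n + 1) - 1 = 3 * n + 2 by omega,
        show (n + 1) * (5 * n + 4) = (n + 1) * (3 * n + 2) + (n + 1) ^ 2 * 2 by ring,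
        Nat.add_mul_div_right _ _ two_pos, add_comm]
  rw [heckeTermOne_eq, baileyD, e, pow_add]
  ring

theorem baileyD_succ {q : ℂ} (hq0 : q ≠ 0) (hq : ∀ k : ℕ, 1 - q * q ^ k ≠ 0)
    (hq' : ∀ k : ℕ, 1 - -q * q ^ k ≠ 0) (n : ℕ) :
    (1 + q ^ (n + 1)) * baileyD q (n + 1) = -((1 - q ^ n) * q ^ (3 * n + 1) * baileyD q n) -
      q ^ (n + 1) * (1 + q ^ (2 * n + 1)) / (1 - q ^ (n + 1)) * baileySource q n := by
  have a1 : 1 - q ^ (n + 1) ≠ 0 := by simpa [pow_succ'] using hq n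
  have a2 : 1 + q ^ (n + 1) ≠ 0 := by simpa [pow_succ'] using hq' n
  have a3 : 1 + q ^ n ≠ 0 := by
    rcases n with _ | n
    · norm_num
    · simpa [pow_succ'] using hq' n
  have hqn : q ^ n ≠ 0 := pow_ne_zero _ hq0
  have hz1 : -(q ^ (1 - ((n + 1 : ℕ) : ℤ))) = -(q ^ n)⁻¹ := by
    rw [show 1 - ((n + 1 : ℕ) : ℤ) = -(n : ℤ) by push_cast; ring, zpow_neg, zpow_natCast]
  have hz2 : -(q ^ (1 - (n : ℤ))) = q * -(q ^ n)⁻¹ := by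
    rw [sub_eq_add_neg, zpow_add₀ hq0, zpow_one, zpow_neg, zpow_natCast]
    ring
  have he : (n + 1) * (3 * (n + 1) - 1) / 2 = n * (3 * n - 1) / 2 + (3 * n + 1) := by
    rcases n with _ | n
    · rfl
    · rw [show 3 * (n + 1 + 1) - 1 = 3 * n + 5 by omega, show 3 * (n + 1) - 1 = 3 * n + 2 by omega,
        show (n + 1 + 1) * (3 * n + 5) = (n + 1) * (3 * n + 2) + (3 * (n + 1) + 1) * 2 by ring,
        Nat.add_mul_div_right _ _ two_pos]
  have he' : n * (3 * n - 1) / 2 + (3 * n + 1) = n * (n + 1) / 2 + (n + 1) + n * (n + 1) := by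
    rw [← he, show 3 * (n + 1) - 1 = 3 * n + 2 by omega,
      show (n + 1) * (3 * n + 2) = n * (n + 1) + ((n + 1) + n * (n + 1)) * 2 by ring,
      Nat.add_mul_div_right _ _ two_pos]
    ring
  have hw : q ^ (n * (3 * n - 1) / 2 + (3 * n + 1)) * (-(q ^ n)⁻¹) ^ (n + 1) =
      -((-1) ^ n * q ^ (n * (n + 1) / 2) * q ^ (n + 1)) := by
    rw [he', pow_add, pow_add, neg_pow, inv_pow, ← pow_mul, pow_succ (-1 : ℂ)]
    have : q ^ (n * (n + 1)) ≠ 0 := pow_ne_zero _ hq0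
    field_simp
  have hc : qPoch (-1) q (n + 1) / qPoch q q (n + 1) =
      (1 + q ^ n) / (1 - q ^ (n + 1)) * (qPoch (-1) q n / qPoch q q n) := by
    rw [qPoch_succ, qPoch_succ, pow_succ']
    have := qPoch_ne_zero hq n; have := hq n
    field_simp
    ring
  have h := truncSeries_sub hq (n + 1) (-(q ^ n)⁻¹)
  have h1 := truncSeries_succ q (n + 1) (-(q ^ n)⁻¹)
  have h2 := truncSeries_succ q (n + 1) (q * -(q ^ n)⁻¹)
  -- The recurrence for the truncated sums themselves.
  have hT : (1 + q ^ n) * truncSeries q (n + 1 + 1) (-(q ^ n)⁻¹) =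
      -((1 - q ^ n) * truncSeries q (n + 1) (q * -(q ^ n)⁻¹)) +
        qPoch (-1) q (n + 1) / qPoch q q (n + 1) * (-(q ^ n)⁻¹) ^ (n + 1) *
          (1 + q ^ (2 * n + 1)) := by
    rw [mul_pow] at h2
    have hinv : q ^ n * (q ^ n)⁻¹ = 1 := mul_inv_cancel₀ hqn
    rw [show 2 * n + 1 = n + (n + 1) by omega, pow_add q n (n + 1)]
    generalize qPoch (-1) q (n + 1) / qPoch q q (n + 1) = c at *
    generalize (-(q ^ n)⁻¹) ^ (n + 1) = W at *
    generalize truncSeries q (n + 1 + 1) (-(q ^ n)⁻¹) = T at *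
    generalize truncSeries q (n + 1 + 1) (q * -(q ^ n)⁻¹) = T2 at *
    generalize truncSeries q (n + 1) (-(q ^ n)⁻¹) = S at *
    generalize truncSeries q (n + 1) (q * -(q ^ n)⁻¹) = S2 at *
    generalize (q ^ n)⁻¹ = V at *
    linear_combination q ^ n * h + h1 + q ^ n * h2 - (S + S2) * hinv
  rw [baileyD, baileyD, hz1, hz2, he, baileySource]
  have b : (1 + q ^ (n + 1)) * (q ^ (n * (3 * n - 1) / 2 + (3 * n + 1)) / (1 + q ^ (n + 1)) *
      truncSeries q (n + 1 + 1) (-(q ^ n)⁻¹)) =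
      q ^ (n * (3 * n - 1) / 2 + (3 * n + 1)) * truncSeries q (n + 1 + 1) (-(q ^ n)⁻¹) := by
    field_simp
  rw [b]
  apply mul_left_cancel₀ a3
  rw [hc] at hT
  have b2 : (1 + q ^ n) * (q ^ (n * (3 * n - 1) / 2 + (3 * n + 1)) *
      truncSeries q (n + 1 + 1) (-(q ^ n)⁻¹)) =
      -((1 - q ^ n) * q ^ (n * (3 * n - 1) / 2 + (3 * n + 1)) *
        truncSeries q (n + 1) (q * -(q ^ n)⁻¹)) +
      (1 + q ^ n) / (1 - q ^ (n + 1)) * (qPoch (-1) q n / qPoch q q n) *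
        -((-1) ^ n * q ^ (n * (n + 1) / 2) * q ^ (n + 1)) * (1 + q ^ (2 * n + 1)) := by
    rw [← hw]
    linear_combination q ^ (n * (3 * n - 1) / 2 + (3 * n + 1)) * hT
  rw [b2, pow_add q (n * (3 * n - 1) / 2)]
  generalize truncSeries q (n + 1) (q * -(q ^ n)⁻¹) = S2
  field_simp
  ring

/-! ### Convergence -/

theorem summable_norm_mul_pow {q : ℂ} (a : ℂ) (hq : ‖q‖ < 1) :
    Summable fun k : ℕ => ‖-(a * q ^ k)‖ := by
  simp only [norm_neg, norm_mul, norm_pow]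
  exact (summable_geometric_of_lt_one (norm_nonneg q) hq).mul_left _

theorem tendsto_qPoch_tprod {q : ℂ} (a : ℂ) (hq : ‖q‖ < 1) :
    Tendsto (fun n : ℕ => qPoch a q n) atTop (𝓝 (∏' k : ℕ, (1 + -(a * q ^ k)))) := by
  have h := (multipliable_one_add_of_summable
    (summable_norm_mul_pow a hq)).tendsto_prod_tprod_nat
  refine h.congr fun n => ?_
  simp only [qPoch, sub_eq_add_neg]

theorem tendsto_qPoch {q : ℂ} (a : ℂ) (hq : ‖q‖ < 1) :
    Tendsto (fun n : ℕ => qPoch a q n) atTop (𝓝 (qPochInf a q)) :=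
  tendsto_nhds_limUnder ⟨_, tendsto_qPoch_tprod a hq⟩

theorem qPochInf_ne_zero {a q : ℂ} (hq : ‖q‖ < 1) (ha : ∀ k : ℕ, 1 - a * q ^ k ≠ 0) :
    qPochInf a q ≠ 0 := by
  rw [tendsto_nhds_unique (tendsto_qPoch a hq) (tendsto_qPoch_tprod a hq)]
  refine tprod_one_add_ne_zero_of_summable (fun k => ?_) (summable_norm_mul_pow a hq)
  simpa [sub_eq_add_neg] using ha k

theorem exists_norm_le_of_tendsto {u : ℕ → ℂ} {x : ℂ} (hu : Tendsto u atTop (𝓝 x)) :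
    ∃ C, 0 ≤ C ∧ ∀ n, ‖u n‖ ≤ C := by
  obtain ⟨C, hC⟩ := isBounded_iff_forall_norm_le.mp (Metric.isBounded_range_of_tendsto u hu)
  have hC' : ∀ n, ‖u n‖ ≤ C := fun n => hC _ ⟨n, rfl⟩
  exact ⟨C, (norm_nonneg _).trans (hC' 0), hC'⟩

theorem exists_norm_inv_qPoch_le {a q : ℂ} (hq : ‖q‖ < 1) (ha : ∀ k : ℕ, 1 - a * q ^ k ≠ 0) :
    ∃ C, 0 ≤ C ∧ ∀ n, ‖(qPoch a q n)⁻¹‖ ≤ C :=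
  exists_norm_le_of_tendsto ((tendsto_qPoch a hq).inv₀ (qPochInf_ne_zero hq ha))

theorem summable_sigma2Term {q : ℂ} (hq : ‖q‖ < 1) : Summable fun n : ℕ => sigma2Term q n := by
  obtain ⟨C, _, hC⟩ := exists_norm_inv_qPoch_le hq
    (one_sub_mul_pow_ne_zero (a := -q) (by rwa [norm_neg]) hq)
  refine Summable.of_norm_bounded
    ((summable_geometric_of_lt_one (norm_nonneg q) hq).mul_right C) fun n => ?_
  rw [sigma2Term, div_eq_mul_inv, norm_mul, norm_mul, norm_pow, norm_pow, norm_neg, norm_one,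
    one_pow, one_mul]
  have h : ‖q‖ ^ (n ^ 2) ≤ ‖q‖ ^ n :=
    pow_le_pow_of_le_one (norm_nonneg q) hq.le (Nat.le_self_pow two_ne_zero n)
  exact mul_le_mul h (hC n) (norm_nonneg _) (by positivity)

/-- The inner sum of the `n`-th term has size `O(n |q|^(-n(n-1)))`, and the exponent
`n (5n - 1) / 2` of the prefactor exceeds `n (n - 1)` by at least `n - 1`. -/
theorem summable_heckeTermOne {q : ℂ} (hq0 : q ≠ 0) (hq : ‖q‖ < 1) :
    Summable fun n : ℕ => heckeTermOne q (n + 1) := by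
  obtain ⟨A, hA0, hA⟩ := exists_norm_inv_qPoch_le hq (one_sub_mul_pow_ne_zero hq hq)
  obtain ⟨B, hB0, hB⟩ := exists_norm_le_of_tendsto (tendsto_qPoch (-1) hq)
  have hlim : Tendsto (fun n : ℕ => (1 + q ^ n)⁻¹) atTop (𝓝 (1 + 0)⁻¹) :=
    ((tendsto_pow_atTop_nhds_zero_of_norm_lt_one hq).const_add 1).inv₀ (by simp)
  obtain ⟨K, hK0, hK⟩ := exists_norm_le_of_tendsto hlim
  have hr0 : 0 < ‖q‖ := norm_pos_iff.mpr hq0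
  have hsum : Summable fun n : ℕ => 2 * K * (((n : ℝ) + 2) * (B * A * ‖q‖ ^ n)) := by
    have h1 := summable_pow_mul_geometric_of_norm_lt_one (R := ℝ) 1 (r := ‖q‖) (by simpa using hq)
    have h2 := summable_geometric_of_lt_one (norm_nonneg q) hq
    refine ((h1.add (h2.mul_left 2)).mul_left (2 * K * (B * A))).congr fun n => ?_
    ring
  refine Summable.of_norm_bounded hsum fun n => ?_
  set E := (n + 1) * (5 * (n + 1) - 1) / 2 with hE
  have hEn : n + n * (n + 1) ≤ E := by
    rw [hE, Nat.le_div_iff_mul_le two_pos, show 5 * (n + 1) - 1 = 5 * n + 4 by omega]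
    nlinarith
  have hz : q ^ (1 - ((n + 1 : ℕ) : ℤ)) = (q ^ n)⁻¹ := by
    rw [show 1 - ((n + 1 : ℕ) : ℤ) = -(n : ℤ) by push_cast; ring, zpow_neg, zpow_natCast]
  have hin : ‖q‖ ^ E * ‖truncSeries q (n + 1 + 1) (-(q ^ (1 - ((n + 1 : ℕ) : ℤ))))‖ ≤
      ((n : ℝ) + 2) * (B * A * ‖q‖ ^ n) := by
    rw [truncSeries, hz]
    calc _ ≤ ‖q‖ ^ E * ∑ j ∈ Finset.range (n + 1 + 1),
          ‖qPoch (-1) q j / qPoch q q j * (-(q ^ n)⁻¹) ^ j‖ := by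
          gcongr
          exact norm_sum_le _ _
      _ = ∑ j ∈ Finset.range (n + 1 + 1),
          ‖q‖ ^ E * ‖qPoch (-1) q j / qPoch q q j * (-(q ^ n)⁻¹) ^ j‖ := Finset.mul_sum _ _ _
      _ ≤ ∑ j ∈ Finset.range (n + 1 + 1), B * A * ‖q‖ ^ n := by
          refine Finset.sum_le_sum fun j hj => ?_
          have hj' : j ≤ n + 1 := Nat.lt_succ_iff.mp (Finset.mem_range.mp hj)
          obtain ⟨t, ht⟩ := Nat.exists_eq_add_of_le
            ((Nat.add_le_add_left (Nat.mul_le_mul_left n hj') n).trans hEn)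
          have hpow : ‖q‖ ^ E * ((‖q‖ ^ n)⁻¹) ^ j ≤ ‖q‖ ^ n := by
            have : ‖q‖ ^ E * ((‖q‖ ^ n)⁻¹) ^ j = ‖q‖ ^ (n + t) := by
              rw [ht, inv_pow, ← pow_mul, show n + n * j + t = n + t + n * j by ring, pow_add,
                mul_inv_cancel_right₀ (by positivity)]
            rw [this]
            exact pow_le_pow_of_le_one hr0.le hq.le (Nat.le_add_right _ _)
          rw [div_eq_mul_inv, norm_mul, norm_mul, norm_pow, norm_neg, norm_inv (q ^ n), norm_pow]
          calc _ = ‖qPoch (-1) q j‖ * ‖(qPoch q q j)⁻¹‖ * (‖q‖ ^ E * ((‖q‖ ^ n)⁻¹) ^ j) := by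
                ring
            _ ≤ B * A * ‖q‖ ^ n := by
                gcongr
                · exact hB j
                · exact hA j
      _ = ((n : ℝ) + 2) * (B * A * ‖q‖ ^ n) := by
          rw [Finset.sum_const, Finset.card_range, nsmul_eq_mul]
          push_cast
          ring
  have h2 : ‖1 + q ^ (2 * (n + 1))‖ ≤ 2 := by
    refine (norm_add_le _ _).trans ?_
    rw [norm_one, norm_pow]
    linarith [pow_le_one₀ (n := 2 * (n + 1)) (norm_nonneg q) hq.le]
  rw [heckeTermOne_eq, div_eq_mul_inv, norm_mul, norm_mul, norm_mul, norm_mul, norm_pow, norm_pow,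
    norm_neg, norm_one, one_pow, one_mul]
  calc _ = ‖1 + q ^ (2 * (n + 1))‖ * ‖(1 + q ^ (n + 1))⁻¹‖ *
        (‖q‖ ^ E * ‖truncSeries q (n + 1 + 1) (-(q ^ (1 - ((n + 1 : ℕ) : ℤ))))‖) := by ring
    _ ≤ _ := by
        gcongr
        exact hK (n + 1)

/-- Tannery's theorem for sums of growing length. -/
theorem tendsto_sum_range_mul {s : ℕ → ℂ} {g : ℕ → ℕ → ℂ} {L : ℂ} {C : ℝ} (hs : Summable s)
    (hg : ∀ n, Tendsto (fun N => g N n) atTop (𝓝 L)) (hC : ∀ N n, ‖g N n‖ ≤ C) :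
    Tendsto (fun N => ∑ n ∈ Finset.range (N + 1), s n * g N n) atTop (𝓝 ((∑' n, s n) * L)) := by
  have h := tendsto_tsum_of_dominated_convergence (𝓕 := atTop)
    (f := fun N n => if n ∈ Finset.range (N + 1) then s n * g N n else 0)
    (g := fun n => s n * L) (hs.norm.mul_right C) (fun n => ?_)
    (Eventually.of_forall fun N n => ?_)
  · rw [tsum_mul_right] at h
    refine h.congr fun N => ?_
    rw [tsum_eq_sum (s := Finset.range (N + 1)) fun n hn => if_neg hn]
    exact Finset.sum_congr rfl fun n hn => if_pos hn
  · refine ((hg n).const_mul (s n)).congr' ?_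
    filter_upwards [eventually_ge_atTop n] with N hN
    rw [if_pos (Finset.mem_range.mpr (Nat.lt_succ_of_le hN))]
  · have hC0 : 0 ≤ C := (norm_nonneg _).trans (hC N n)
    split_ifs
    · rw [norm_mul]
      exact mul_le_mul_of_nonneg_left (hC N n) (norm_nonneg _)
    · rw [norm_zero]
      positivity

/-! ### The representations of `σ₂` -/

theorem sigma2_eq_tsum_heckeTermOne {q : ℂ} (hq0 : q ≠ 0) (hq : ‖q‖ < 1) :
    sigma2 q = 1 / qPochInf (-q) q * (1 + ∑' n : ℕ, heckeTermOne q (n + 1)) := by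
  have hP := one_sub_mul_pow_ne_zero hq hq
  have hM := one_sub_mul_pow_ne_zero (a := -q) (by rwa [norm_neg]) hq
  obtain ⟨A, hA0, hA⟩ := exists_norm_inv_qPoch_le hq hP
  obtain ⟨B, hB0, hB⟩ := exists_norm_inv_qPoch_le hq hM
  have hPi := qPochInf_ne_zero hq hP
  have hMi := qPochInf_ne_zero hq hM
  have hfin : ∀ N : ℕ, ∑ n ∈ Finset.range (N + 1), sigma2Term q n * (qPoch q q (N - n))⁻¹ =
      ∑ r ∈ Finset.range (N + 1),
        heckeTermOne q r * ((qPoch q q (N - r))⁻¹ * (qPoch (-q) q (N + r))⁻¹) := by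
    intro N
    have h := finite_bailey_lemma (a := -1) (α := fun r => (1 + q ^ (2 * r)) * baileyD q r)
      (β := fun n => 1 / qPoch (-q) q n) hP (by simpa using hM)
      (by simpa using inv_qPoch_eq_bailey_sum hP hM (baileyD_zero q) (baileyD_succ hq0 hP hM)) N
    rw [neg_one_mul] at h
    convert h using 2 with n _ n _
    · rw [sigma2Term]
      ring
    · rw [heckeTermOne_eq_baileyD, ← mul_inv, div_eq_mul_inv]
  have hs := summable_heckeTermOne hq0 hq
  have hs' : Summable fun n : ℕ => heckeTermOne q n := (summable_nat_add_iff 1).mp hs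
  have hlimP : ∀ n : ℕ, Tendsto (fun N => (qPoch q q (N - n))⁻¹) atTop (𝓝 (qPochInf q q)⁻¹) :=
    fun n => ((tendsto_qPoch q hq).inv₀ hPi).comp (tendsto_sub_atTop_nat n)
  have hlimM : ∀ n : ℕ,
      Tendsto (fun N => (qPoch (-q) q (N + n))⁻¹) atTop (𝓝 (qPochInf (-q) q)⁻¹) :=
    fun n => ((tendsto_qPoch (-q) hq).inv₀ hMi).comp (tendsto_add_atTop_nat n)
  have l1 := tendsto_sum_range_mul (summable_sigma2Term hq) hlimP fun N n => hA (N - n)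
  have l2 := tendsto_sum_range_mul hs' (fun n => (hlimP n).mul (hlimM n)) (C := A * B)
    fun N n => by
      rw [norm_mul]
      exact mul_le_mul (hA _) (hB _) (norm_nonneg _) hA0
  have h := tendsto_nhds_unique (l1.congr hfin) l2
  have hzero : heckeTermOne q 0 = 1 := by
    rw [heckeTermOne_eq_baileyD, baileyD_zero]
    norm_num
  rw [hs'.tsum_eq_zero_add, hzero, ← sigma2] at h
  rw [one_div]
  apply mul_right_cancel₀ (inv_ne_zero hPi)
  rw [h]
  ring

theorem theorem1p5 (q : ℂ) (hq : ‖q‖ < 1) :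
    -- the infinite product converges to a nonzero limit and the series for `σ₂` converges
    (Tendsto (fun n : ℕ => qPoch (-q) q n) atTop (𝓝 (qPochInf (-q) q)) ∧
      qPochInf (-q) q ≠ 0 ∧ Summable (fun n : ℕ => sigma2Term q n)) ∧
    -- (i), the sum running over the integers `n + 1 ≥ 1`
    (Summable (fun n : ℕ => heckeTermOne q (n + 1)) ∧
      sigma2 q = 1 / qPochInf (-q) q * (1 + ∑' n : ℕ, heckeTermOne q (n + 1))) ∧
    -- (ii), the sum running over the integers `n + 1 ≥ 1`
    (Summable (fun n : ℕ => heckeTermTwo q (n + 1)) ∧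
      sigma2 q = 1 / qPochInf (-q) q * (1 - ∑' n : ℕ, heckeTermTwo q (n + 1))) := by
  have hP := one_sub_mul_pow_ne_zero hq hq
  have hM := one_sub_mul_pow_ne_zero (a := -q) (by rwa [norm_neg]) hq
  refine ⟨⟨tendsto_qPoch (-q) hq, qPochInf_ne_zero hq hM, summable_sigma2Term hq⟩, ?_⟩
  rcases eq_or_ne q 0 with rfl | hq0
  · have hE : ∀ n : ℕ, (0 : ℂ) ^ ((n + 1) * (5 * (n + 1) - 1) / 2) = 0 := fun n => by
      apply zero_pow
      rw [show 5 * (n + 1) - 1 = 5 * n + 4 by omega]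
      have : 2 ≤ (n + 1) * (5 * n + 4) := by nlinarith
      exact (Nat.div_pos this two_pos).ne'
    have h1 : ∀ n : ℕ, heckeTermOne 0 (n + 1) = 0 := fun n => by rw [heckeTermOne, hE]; simp
    have h2 : ∀ n : ℕ, heckeTermTwo 0 (n + 1) = 0 := fun n => by rw [heckeTermTwo, hE]; simp
    have hone : qPochInf (-0) 0 = 1 :=
      tendsto_nhds_unique (tendsto_qPoch (-0) hq)
        (tendsto_const_nhds.congr fun n => by simp [qPoch])
    have hs : sigma2 0 = 1 := by
      rw [sigma2, tsum_eq_single 0 fun n hn => by simp [sigma2Term, hn]]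
      simp [sigma2Term, qPoch]
    simp only [h1, h2, hone, hs]
    simp [summable_zero]
  · have hneg : (fun n : ℕ => heckeTermTwo q (n + 1)) = fun n => -heckeTermOne q (n + 1) :=
      funext (heckeTermTwo_succ hq0 hP hM)
    have hs := summable_heckeTermOne hq0 hq
    have h := sigma2_eq_tsum_heckeTermOne hq0 hq
    refine ⟨⟨hs, h⟩, ?_⟩
    rw [hneg, tsum_neg, sub_neg_eq_add]
    exact ⟨hs.neg, h⟩
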